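/- For $q>0$ and $t\in\mathbb R$ put $[t]_q=\frac{q^t-q^{-t}}{q-q^{-1}}$ if $q\neq1$ and $[t]_1=t$. For $S\in\frac12\mathbb Z_{\ge0}=\{0,\frac12,1,\dots\}$ let $\mathcal H_S=\mathbb C^{2S+1}$ with orthonormal basis $|k\rangle$, $k=S,S-1,\dots,-S$, be the spin-$S$ irreducible $*$-representation of $U_q(su_2)$ (of $U(su_2)$ if $q=1$): $$H|k\rangle=k|k\rangle,\quad K^{\pm1}|k\rangle=q^{\pm k}|k\rangle,\quad X^{\pm}|k\rangle=\sqrt{[S\mp k]_q[S\pm k+1]_q}\;|k\pm1\rangle .$$ On $\mathcal H_S\otimes\mathcal H_S$ let $\Delta(X^\pm)=X^\pm\otimes K+K^{-1}\otimes X^\pm$, $\Delta(K^{\pm1})=K^{\pm1}\otimes K^{\pm1}$, $\Delta(H)=H\otimes1+1\otimes H$, and let $\Delta(C_q)$ be the action of the Casimir element $C_q=X^-X^++\frac{(K-K^{-1})(qK-q^{-1}K^{-1})}{(q-q^{-1})^2}$ for $q\ne1$, $C_1=X^-X^++H(H+1)$. For integers $0\le J\le 2S$ and $-J\le m\le J$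 let $|J,m\rangle_q\in\mathcal H_S\otimes\mathcal H_S$ be the normalized joint eigenvector, unique up to a phase, of $\Delta(K)$ with eigenvalue $q^m$ (of $\Delta(H)$ with eigenvalue $m$ if $q=1$) and of $\Delta(C_q)$ with eigenvalue $[J]_q[J+1]_q$. Let $P$ be the orthogonal projection of $\mathcal H_S\otimes\mathcal H_S$ onto the line spanned by $|J,m\rangle_q$. The vector $|J,m\rangle_q$ is called a TL vector if for some $Q>0$ the operator $T=QP$ satisfies $$T^*=T,\qquad T^2=QT,\qquad T_{12}T_{23}T_{12}=T_{12},\qquad T_{23}T_{12}T_{23}=T_{23},$$ where $T_{12}=T\otimes1$ and $T_{23}=1\otimes T$ act on $\mathcal H_S^{\otimes3}$. Theorem. a) For $q=1$, the exhaustive list of TL vectors $|J,m\rangle_{q=1}$ is: $|0,0\rangle_{q=1}$ for all $S\in\frac12\mathbb Z_{\ge0}$; $|1,0\rangle_{q=1}$ for $S=\frac12$; $|2,0\rangle_{q=1}$ for $S=\frac32$. In all three cases the corresponding value of $Q$ is $Q=2S+1$. b) The exhaustive list of vectors $|J,m\rangle_q$ which are TL vectors for all $q>0$ is: $|0,0\rangle_q$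 for all $S\in\frac12\mathbb Z_{\ge0}$; $|1,0\rangle_q$ for $S=\frac12$. In both cases the corresponding value of $Q$ is $Q=[2S+1]_q$. -/

import Mathlib

open Matrix
open scoped Kronecker

noncomputable section

namespace TLVec

/-! ## Spin-`S` modules

The spin `S ∈ {0, 1/2, 1, ...}` is encoded by the natural number `twoS = 2S`.  The module `H_S` is
`ℂ^(2S+1)` with the orthonormal basis `e_a`, `a = 0, ..., 2S`, where `e_a = |S - a⟩`. -/

/-- The q-number `[t]_q`. -/
def qNum (q t : ℝ) : ℝ :=
  if q = 1 then t else (q ^ t - q ^ (-t)) / (q - q⁻¹)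

/-- The spin `S`. -/
def spin (twoS : ℕ) : ℝ := (twoS : ℝ) / 2

/-- The weight `S - a` of the basis vector `e_a`. -/
def weight (twoS : ℕ) (a : Fin (twoS + 1)) : ℝ := spin twoS - (a : ℕ)

/-- Operators on `H_S`. -/
abbrev Op (twoS : ℕ) := Matrix (Fin (twoS + 1)) (Fin (twoS + 1)) ℂ

/-- Operators on `H_S ⊗ H_S`; the basis vector `e_a ⊗ e_b` has index `(a, b)`. -/
abbrev Op2 (twoS : ℕ) :=
  Matrix (Fin (twoS + 1) × Fin (twoS + 1)) (Fin (twoS + 1) × Fin (twoS + 1)) ℂ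

/-- Operators on `H_S ⊗ H_S ⊗ H_S`. -/
abbrev Op3 (twoS : ℕ) :=
  Matrix ((Fin (twoS + 1) × Fin (twoS + 1)) × Fin (twoS + 1))
    ((Fin (twoS + 1) × Fin (twoS + 1)) × Fin (twoS + 1)) ℂ

/-- The Hilbert space `H_S ⊗ H_S`. -/
abbrev Space2 (twoS : ℕ) := EuclideanSpace ℂ (Fin (twoS + 1) × Fin (twoS + 1))

/-- `H |m⟩ = m |m⟩`. -/
def opH (twoS : ℕ) : Op twoS := diagonal fun a => ((weight twoS a : ℝ) : ℂ)

/-- `K |m⟩ = q^m |m⟩`. -/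
def opK (twoS : ℕ) (q : ℝ) : Op twoS := diagonal fun a => ((q ^ weight twoS a : ℝ) : ℂ)

/-- `K⁻¹ |m⟩ = q^(-m) |m⟩`. -/
def opKinv (twoS : ℕ) (q : ℝ) : Op twoS := diagonal fun a => ((q ^ (-weight twoS a) : ℝ) : ℂ)

/-- `X⁺ |m⟩ = ([S - m] [S + m + 1])^(1/2) |m + 1⟩`. -/
def opXp (twoS : ℕ) (q : ℝ) : Op twoS := of fun a b =>
  if (a : ℕ) + 1 = (b : ℕ) then
    ((Real.sqrt (qNum q (spin twoS - weight twoS b) *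
      qNum q (spin twoS + weight twoS b + 1)) : ℝ) : ℂ)
  else 0

/-- `X⁻ = (X⁺)*`. -/
def opXm (twoS : ℕ) (q : ℝ) : Op twoS := (opXp twoS q)ᴴ

/-! ## The tensor square

The comultiplication is `Δ(X^±) = X^± ⊗ K + K⁻¹ ⊗ X^±`, `Δ(K^±1) = K^±1 ⊗ K^±1`,
`Δ(H) = H ⊗ 1 + 1 ⊗ H`.  For `q = 1` one has `K = 1`, so that `Δ(X^±) = X^± ⊗ 1 + 1 ⊗ X^±`. -/

/-- The action of `Δ(H)` (used for `q = 1`). -/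
def deltaH (twoS : ℕ) : Op2 twoS := opH twoS ⊗ₖ 1 + 1 ⊗ₖ opH twoS

/-- The action of `Δ(K)`. -/
def deltaK (twoS : ℕ) (q : ℝ) : Op2 twoS := opK twoS q ⊗ₖ opK twoS q

/-- The action of `Δ(K⁻¹)`. -/
def deltaKinv (twoS : ℕ) (q : ℝ) : Op2 twoS := opKinv twoS q ⊗ₖ opKinv twoS q

/-- The action of `Δ(X⁺)`. -/
def deltaXp (twoS : ℕ) (q : ℝ) : Op2 twoS :=
  opXp twoS q ⊗ₖ opK twoS q + opKinv twoS q ⊗ₖ opXp twoS q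

/-- The action of `Δ(X⁻)`. -/
def deltaXm (twoS : ℕ) (q : ℝ) : Op2 twoS :=
  opXm twoS q ⊗ₖ opK twoS q + opKinv twoS q ⊗ₖ opXm twoS q

/-- The action of `Δ(C_q)`, where `C_1 = X⁻ X⁺ + H (H + 1)` for `q = 1` and
`C_q = X⁻ X⁺ + (K - K⁻¹) (q K - q⁻¹ K⁻¹) / (q - q⁻¹)²` for `q ≠ 1`. -/
def deltaC (twoS : ℕ) (q : ℝ) : Op2 twoS :=
  if q = 1 then
    deltaXm twoS q * deltaXp twoS q + deltaH twoS * (deltaH twoS + 1)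
  else
    deltaXm twoS q * deltaXp twoS q +
      (((q - q⁻¹) ^ 2 : ℝ) : ℂ)⁻¹ •
        ((deltaK twoS q - deltaKinv twoS q) *
          ((q : ℂ) • deltaK twoS q - (q : ℂ)⁻¹ • deltaKinv twoS q))

/-- `v` is the vector `|J, m⟩_q` of `H_S ⊗ H_S`, i.e. (uniquely up to a phase, for `0 ≤ J ≤ 2S` and
`-J ≤ m ≤ J`) the normalized joint eigenvector of `Δ(K)` and `Δ(C_q)`, or of `Δ(H)` and `Δ(C_1)` if
`q = 1`, with eigenvalues `q^m` (resp. `m`) and `[J] [J + 1]`. -/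
structure IsKet (twoS : ℕ) (q : ℝ) (J : ℕ) (m : ℤ) (v : Space2 twoS) : Prop where
  norm_eq : ‖v‖ = 1
  weight_eq : if q = 1 then deltaH twoS *ᵥ v.ofLp = (m : ℂ) • v.ofLp
    else deltaK twoS q *ᵥ v.ofLp = ((q ^ m : ℝ) : ℂ) • v.ofLp
  casimir_eq : deltaC twoS q *ᵥ v.ofLp = ((qNum q J * qNum q (J + 1) : ℝ) : ℂ) • v.ofLp

/-! ## The Temperley–Lieb equations -/

/-- `T₁₂ = T ⊗ 1`. -/
def leg12 {twoS : ℕ} (T : Op2 twoS) : Op3 twoS := T ⊗ₖ (1 : Op twoS)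

/-- `T₂₃ = 1 ⊗ T`. -/
def leg23 {twoS : ℕ} (T : Op2 twoS) : Op3 twoS :=
  ((1 : Op twoS) ⊗ₖ T).submatrix (Equiv.prodAssoc _ _ _) (Equiv.prodAssoc _ _ _)

/-- The equations (T1)-(T4). -/
structure IsTLSolution {twoS : ℕ} (Q : ℝ) (T : Op2 twoS) : Prop where
  t1 : Tᴴ = T
  t2 : T * T = (Q : ℂ) • T
  t3 : leg12 T * leg23 T * leg12 T = leg12 T
  t4 : leg23 T * leg12 T * leg23 T = leg23 T

/-- The matrix of the orthogonal projection onto the line spanned by `v`. -/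
def proj {twoS : ℕ} (v : Space2 twoS) : Op2 twoS :=
  (Matrix.toEuclideanCLM (n := Fin (twoS + 1) × Fin (twoS + 1)) (𝕜 := ℂ)).symm
    (Submodule.span ℂ {v}).starProjection

/-- `|J, m⟩_q` is a TL vector: for some `Q > 0`, `T = Q P` solves (T1)-(T4), where `P` is the
orthogonal projection onto the line spanned by `|J, m⟩_q`. -/
def IsTLVector (twoS : ℕ) (q : ℝ) (J : ℕ) (m : ℤ) : Prop :=
  ∃ v : Space2 twoS, IsKet twoS q J m v ∧
    ∃ Q : ℝ, 0 < Q ∧ IsTLSolution Q ((Q : ℂ) • proj v)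

end TLVec

end

noncomputable section

namespace TLVec

/-! ## The Temperley–Lieb equations for rank one projections -/

section RankOne

variable {twoS : ℕ}

/-! Write the rank one projections on three legs as `A Aᴴ` and `B Bᴴ`, with isometries `A : e_d ↦ v
⊗ e_d` and `B : e_d ↦ e_d ⊗ v`. The Temperley–Lieb equations for `Q P` then say exactly that `Q`
times `Aᴴ B`, the `overlap` of `v`, is unitary (`isTLSolution_iff_overlap`). If `m ≠ 0`, the weight
condition makes a column of the coefficient matrix of `v` vanish, the overlap is singular, and `v`
is excluded.

If `m = 0`, then `v` has coefficients `q^(S - a) y_a` on the antidiagonal, the overlap is diagonal,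
and unitarity becomes `Q |y_a| |y_(2S - a)| = 1` for all `a`. The Casimir equation is a three-term
recurrence for `y` whose solution is unique up to a scalar (`IsCasimirSeq.proportional`). Explicit
solutions give the listed vectors, and the normalization of `v` gives `Q`.

For completeness at `q = 1`, the recurrence is reversal invariant, so all `|y_a|` are equal
(`norm_const_of_one_param`). Its coefficients are real, and the first rows then leave few ratios
`±1`: for `J > 0` they force `J(J + 1) = 2 · 2S` and `2S = 1` or `2S = 3`. A vector that is TL for
all `q` is in the list at `q = 1`, and the extra case `S = 3/2` fails at `q = 2`. -/

theorem proj_apply (v : Space2 twoS) (hv : ‖v‖ = 1) (i j) :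
    proj v i j = v.ofLp i * star (v.ofLp j) := by
  have h : (Matrix.toEuclideanCLM (n := Fin (twoS + 1) × Fin (twoS + 1)) (𝕜 := ℂ)) (proj v) =
      (Submodule.span ℂ {v}).starProjection := by
    simp [proj]
  have h2 := congrArg (fun f => (f (EuclideanSpace.single j 1)).ofLp i) h
  simp only [Submodule.starProjection_unit_singleton ℂ hv] at h2
  simpa [mul_comm, EuclideanSpace.inner_single_right] using h2

/-- The isometry `e_d ↦ v ⊗ e_d`. -/
def insertRight (v : Space2 twoS) :
    Matrix ((Fin (twoS + 1) × Fin (twoS + 1)) × Fin (twoS + 1)) (Fin (twoS + 1)) ℂ :=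
  of fun i d => if i.2 = d then v.ofLp i.1 else 0

/-- The isometry `e_d ↦ e_d ⊗ v`. -/
def insertLeft (v : Space2 twoS) :
    Matrix ((Fin (twoS + 1) × Fin (twoS + 1)) × Fin (twoS + 1)) (Fin (twoS + 1)) ℂ :=
  of fun i d => if i.1.1 = d then v.ofLp (i.1.2, i.2) else 0

/-- The matrix `M̄ M` transposed, where `M` is the coefficient matrix of `v`. -/
def overlap (v : Space2 twoS) : Op twoS :=
  of fun d e => ∑ b, star (v.ofLp (e, b)) * v.ofLp (b, d)

theorem leg12_proj (v : Space2 twoS) (hv : ‖v‖ = 1) :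
    leg12 (proj v) = insertRight v * (insertRight v)ᴴ := by
  ext ⟨⟨a, b⟩, c⟩ ⟨⟨a', b'⟩, c'⟩
  by_cases h : c = c' <;>
    simp [leg12, insertRight, mul_apply, proj_apply v hv, one_apply, h, Ne.symm]

theorem leg23_proj (v : Space2 twoS) (hv : ‖v‖ = 1) :
    leg23 (proj v) = insertLeft v * (insertLeft v)ᴴ := by
  ext ⟨⟨a, b⟩, c⟩ ⟨⟨a', b'⟩, c'⟩
  by_cases h : a = a' <;>
    simp [leg23, insertLeft, mul_apply, proj_apply v hv, one_apply, h, Ne.symm]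

theorem sum_star_mul_self (v : Space2 twoS) (hv : ‖v‖ = 1) :
    ∑ a, ∑ b, star (v.ofLp (a, b)) * v.ofLp (a, b) = 1 := by
  have h := EuclideanSpace.norm_sq_eq v
  rw [hv, Fintype.sum_prod_type] at h
  have h2 := congrArg (fun x : ℝ => (x : ℂ)) h
  simp only [Complex.ofReal_sum, Complex.ofReal_pow, Complex.ofReal_one, one_pow] at h2
  rw [h2]
  refine Finset.sum_congr rfl fun a _ => Finset.sum_congr rfl fun b _ => ?_
  exact Complex.conj_mul' _

theorem insertRight_isometry (v : Space2 twoS) (hv : ‖v‖ = 1) :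
    (insertRight v)ᴴ * insertRight v = 1 := by
  ext d e
  by_cases h : d = e
  · subst h
    simpa [insertRight, mul_apply, Fintype.sum_prod_type, apply_ite] using sum_star_mul_self v hv
  · simp [insertRight, mul_apply, Fintype.sum_prod_type, apply_ite, h, Ne.symm h]

theorem insertLeft_isometry (v : Space2 twoS) (hv : ‖v‖ = 1) :
    (insertLeft v)ᴴ * insertLeft v = 1 := by
  ext d e
  by_cases h : d = e
  · subst h
    have := sum_star_mul_self v hv
    simp only [insertLeft, mul_apply, conjTranspose_apply, of_apply, Fintype.sum_prod_type,
      one_apply_eq]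
    rw [Finset.sum_eq_single d]
    · simpa using this
    · intro x _ hx
      simp [hx]
    · simp
  · simp only [insertLeft, mul_apply, conjTranspose_apply, of_apply, Fintype.sum_prod_type,
      one_apply_ne h]
    refine Finset.sum_eq_zero fun x _ => Finset.sum_eq_zero fun y _ =>
      Finset.sum_eq_zero fun z _ => ?_
    by_cases hx : x = d
    · simp [hx, h]
    · simp [hx]

/-- The third leg is fixed to `d` and the first to `e`, so only the middle leg is summed; this turns
the three-leg problem into one on a single leg. -/
theorem insertRight_conjTranspose_mul_insertLeft (v : Space2 twoS) :
    (insertRight v)ᴴ * insertLeft v = overlap v := by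
  ext d e
  simp only [insertLeft, insertRight, overlap, mul_apply, conjTranspose_apply, of_apply,
    Fintype.sum_prod_type]
  rw [Finset.sum_eq_single e]
  · simp [apply_ite]
  · intro x _ hx
    simp [hx]
  · simp

theorem proj_conjTranspose (v : Space2 twoS) (hv : ‖v‖ = 1) : (proj v)ᴴ = proj v := by
  ext i j
  simp [proj_apply v hv, mul_comm]

theorem proj_mul_self (v : Space2 twoS) (hv : ‖v‖ = 1) : proj v * proj v = proj v := by
  ext i j
  have := sum_star_mul_self v hv
  rw [← Fintype.sum_prod_type (f := fun i => star (v.ofLp i) * v.ofLp i)] at this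
  simp only [mul_apply, proj_apply v hv]
  calc ∑ x, v.ofLp i * star (v.ofLp x) * (v.ofLp x * star (v.ofLp j))
      = ∑ x, (star (v.ofLp x) * v.ofLp x) * (v.ofLp i * star (v.ofLp j)) :=
        Finset.sum_congr rfl fun x _ => by ring
    _ = _ := by rw [← Finset.sum_mul, this, one_mul]

theorem leg12_smul (c : ℂ) (T : Op2 twoS) : leg12 (c • T) = c • leg12 T := by
  simp [leg12, smul_kronecker]

theorem leg23_smul (c : ℂ) (T : Op2 twoS) : leg23 (c • T) = c • leg23 T := by
  ext i j
  simp [leg23]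
  ring

/-- For a matrix `A` with orthonormal columns, `A X Aᴴ` determines `X`. -/
theorem isometry_conj_eq_iff {m n : Type*} [Fintype m] [Fintype n] [DecidableEq n]
    {A : Matrix m n ℂ} (hA : Aᴴ * A = 1) (c : ℂ) (hc : c ≠ 0) (X : Matrix n n ℂ) :
    c ^ 3 • (A * X * Aᴴ) = c • (A * Aᴴ) ↔ c ^ 2 • X = 1 := by
  constructor
  · intro h
    -- Sandwiching between `Aᴴ` and `A` undoes the conjugation, since `Aᴴ A = 1`.
    have h2 := congrArg (fun Y => Aᴴ * Y * A) h
    simp only [Matrix.mul_smul, Matrix.smul_mul] at h2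
    have h3 : Aᴴ * (A * X * Aᴴ) * A = X := by
      calc Aᴴ * (A * X * Aᴴ) * A = (Aᴴ * A) * X * (Aᴴ * A) := by simp only [Matrix.mul_assoc]
        _ = X := by simp [hA]
    have h4 : Aᴴ * (A * Aᴴ) * A = 1 := by
      calc Aᴴ * (A * Aᴴ) * A = (Aᴴ * A) * (Aᴴ * A) := by simp only [Matrix.mul_assoc]
        _ = 1 := by simp [hA]
    rw [h3, h4] at h2
    have h5 := congrArg (fun Y => c⁻¹ • Y) h2
    simp only [smul_smul] at h5
    rw [inv_mul_cancel₀ hc, one_smul] at h5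
    rw [← h5]
    congr 1
    field_simp
  · intro h
    have : c ^ 3 • (A * X * Aᴴ) = c • (A * (c ^ 2 • X) * Aᴴ) := by
      simp only [Matrix.mul_smul, Matrix.smul_mul, smul_smul]
      congr 1
      ring
    rw [this, h, Matrix.mul_one]

/-- `Q P` solves the Temperley–Lieb equations iff `Q` times the overlap matrix is unitary. -/
theorem isTLSolution_iff_overlap (v : Space2 twoS) (hv : ‖v‖ = 1) (Q : ℝ) (hQ : 0 < Q) :
    IsTLSolution Q ((Q : ℂ) • proj v) ↔
      (Q : ℂ) ^ 2 • (overlap v * (overlap v)ᴴ) = 1 := by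
  have hc : (Q : ℂ) ≠ 0 := by exact_mod_cast hQ.ne'
  set A := insertRight v with hAdef
  set B := insertLeft v with hBdef
  have hA : Aᴴ * A = 1 := insertRight_isometry v hv
  have hB : Bᴴ * B = 1 := insertLeft_isometry v hv
  have hR : Aᴴ * B = overlap v := insertRight_conjTranspose_mul_insertLeft v
  have hR' : Bᴴ * A = (overlap v)ᴴ := by rw [← hR]; simp
  have e3 : leg12 ((Q : ℂ) • proj v) * leg23 ((Q : ℂ) • proj v) * leg12 ((Q : ℂ) • proj v) =
      (Q : ℂ) ^ 3 • (A * (overlap v * (overlap v)ᴴ) * Aᴴ) := by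
    rw [leg12_smul, leg23_smul, leg12_proj v hv, leg23_proj v hv, ← hR', ← hR]
    simp only [Matrix.mul_smul, Matrix.smul_mul, smul_smul, Matrix.mul_assoc, ← hAdef, ← hBdef]
    congr 1
    ring
  have e4 : leg23 ((Q : ℂ) • proj v) * leg12 ((Q : ℂ) • proj v) * leg23 ((Q : ℂ) • proj v) =
      (Q : ℂ) ^ 3 • (B * ((overlap v)ᴴ * overlap v) * Bᴴ) := by
    rw [leg12_smul, leg23_smul, leg12_proj v hv, leg23_proj v hv, ← hR', ← hR]
    simp only [Matrix.mul_smul, Matrix.smul_mul, smul_smul, Matrix.mul_assoc, ← hAdef, ← hBdef]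
    congr 1
    ring
  have i3 := isometry_conj_eq_iff hA (Q : ℂ) hc (overlap v * (overlap v)ᴴ)
  have i4 := isometry_conj_eq_iff hB (Q : ℂ) hc ((overlap v)ᴴ * overlap v)
  constructor
  · intro h
    rw [← i3, ← e3, h.t3, leg12_smul, leg12_proj v hv]
  · intro h
    have h' : (Q : ℂ) ^ 2 • ((overlap v)ᴴ * overlap v) = 1 := by
      rw [← Matrix.smul_mul] at h ⊢
      rw [Matrix.smul_mul, ← Matrix.mul_smul]
      -- The overlap is a square matrix, so a right inverse is a left inverse: the third equation
      -- implies the fourth.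
      exact mul_eq_one_comm.mp h
    refine ⟨?_, ?_, ?_, ?_⟩
    · rw [conjTranspose_smul, proj_conjTranspose v hv]
      simp
    · simp only [Matrix.smul_mul, Matrix.mul_smul, proj_mul_self v hv]
    · rw [e3, i3.mpr h, leg12_smul, leg12_proj v hv]
    · rw [e4, i4.mpr h', leg23_smul, leg23_proj v hv]

end RankOne

/-! ## Vectors of weight zero -/

/-- The product `[b] [2S + 1 - b]`, the square of the matrix coefficient of `X⁺` at `e_b`. -/
def hop (twoS : ℕ) (q : ℝ) (b : ℕ) : ℝ := qNum q b * qNum q (twoS + 1 - b)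

/-- The weight zero vector with coefficient `q^(S - a) y_a` at `e_a ⊗ e_(2S - a)`. -/
def ofSeq (twoS : ℕ) (q : ℝ) (y : ℕ → ℂ) : Space2 twoS :=
  WithLp.toLp 2 fun i =>
    if (i.1 : ℕ) + i.2 = twoS then ((q ^ (spin twoS - (i.1 : ℕ)) : ℝ) : ℂ) * y i.1 else 0

theorem ofSeq_apply (twoS : ℕ) (q : ℝ) (y : ℕ → ℂ) (a b : Fin (twoS + 1)) :
    (ofSeq twoS q y).ofLp (a, b) =
      if (a : ℕ) + b = twoS then ((q ^ (spin twoS - (a : ℕ)) : ℝ) : ℂ) * y a else 0 := rfl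

/-- The three-term recurrence expressing that `ofSeq twoS q y` is an eigenvector of the Casimir
operator. -/
def IsCasimirSeq (twoS : ℕ) (q lam : ℝ) (y : ℕ → ℂ) : Prop :=
  ∀ a ≤ twoS, (hop twoS q (a + 1) : ℂ) * (y (a + 1) + y a) +
    (hop twoS q a : ℂ) * (y a + y (a - 1)) = ((lam * q ^ ((twoS : ℝ) - 2 * a) : ℝ) : ℂ) * y a

/-! ### q-numbers and the coefficients `hop` -/

theorem qNum_zero (q : ℝ) : qNum q 0 = 0 := by
  simp [qNum]

theorem sub_inv_ne_zero {q : ℝ} (hq : 0 < q) (h1 : q ≠ 1) : q - q⁻¹ ≠ 0 := by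
  intro h
  have : q * q = 1 := by
    field_simp at h
    nlinarith
  exact h1 (by nlinarith)

theorem qNum_one {q : ℝ} (hq : 0 < q) : qNum q 1 = 1 := by
  unfold qNum
  split_ifs with h
  · rfl
  · rw [Real.rpow_one, Real.rpow_neg_one, div_self (sub_inv_ne_zero hq h)]

theorem qNum_pos {q : ℝ} (hq : 0 < q) {t : ℝ} (ht : 0 < t) : 0 < qNum q t := by
  unfold qNum
  split_ifs with h
  · exact ht
  · rcases lt_or_gt_of_ne h with h | h
    · have h1 : q ^ t < q ^ (-t) := Real.rpow_lt_rpow_of_exponent_gt hq h (by linarith)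
      have h2 : 1 < q⁻¹ := (one_lt_inv₀ hq).mpr h
      exact div_pos_of_neg_of_neg (by linarith) (by linarith)
    · have h1 : q ^ (-t) < q ^ t := Real.rpow_lt_rpow_of_exponent_lt h (by linarith)
      have h2 : q⁻¹ < 1 := inv_lt_one_of_one_lt₀ h
      exact div_pos (by linarith) (by linarith)

theorem qNum_nonneg {q : ℝ} (hq : 0 < q) {t : ℝ} (ht : 0 ≤ t) : 0 ≤ qNum q t := by
  rcases ht.eq_or_lt with rfl | ht
  · rw [qNum_zero]
  · exact (qNum_pos hq ht).le

/-- The two boundary zeros, here and in `hop_top`, remove from the recurrence the meaningless terms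
`y (0 - 1)` and `y (twoS + 1)`. -/
theorem hop_zero (twoS : ℕ) (q : ℝ) : hop twoS q 0 = 0 := by
  simp [hop, qNum_zero]

theorem hop_top (twoS : ℕ) (q : ℝ) : hop twoS q (twoS + 1) = 0 := by
  simp [hop, qNum_zero]

/-- This reflection gives the two summands of `Δ(X^±)` the same square root, which can then be
factored out. -/
theorem hop_symm (twoS : ℕ) (q : ℝ) {a b : ℕ} (h : a + b = twoS + 1) :
    hop twoS q a = hop twoS q b := by
  have h' : (a : ℝ) + b = twoS + 1 := by exact_mod_cast h
  unfold hop
  rw [show (twoS : ℝ) + 1 - a = b by linarith, show (twoS : ℝ) + 1 - b = a by linarith, mul_comm]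

theorem hop_nonneg (twoS : ℕ) {q : ℝ} (hq : 0 < q) {b : ℕ} (hb : b ≤ twoS + 1) :
    0 ≤ hop twoS q b := by
  have h' : (b : ℝ) ≤ twoS + 1 := by exact_mod_cast hb
  exact mul_nonneg (qNum_nonneg hq (by positivity)) (qNum_nonneg hq (by linarith))

theorem hop_pos (twoS : ℕ) {q : ℝ} (hq : 0 < q) {b : ℕ} (h0 : 0 < b) (hb : b ≤ twoS) :
    0 < hop twoS q b := by
  have h' : (b : ℝ) ≤ twoS := by exact_mod_cast hb
  exact mul_pos (qNum_pos hq (by exact_mod_cast h0)) (qNum_pos hq (by linarith))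

/-! ### The Casimir operator on weight zero vectors -/

theorem opXp_apply (twoS : ℕ) (q : ℝ) (a b : Fin (twoS + 1)) :
    opXp twoS q a b = if (a : ℕ) + 1 = b then ((Real.sqrt (hop twoS q b) : ℝ) : ℂ) else 0 := by
  simp only [opXp, of_apply, hop, weight, spin]
  congr 5 <;> ring_nf

theorem sum_fin_ite_succ_eq (n a : ℕ) (f : ℕ → ℂ) :
    ∑ x : Fin (n + 1), (if a + 1 = (x : ℕ) then f x else 0) = if a + 1 ≤ n then f (a + 1) else 0 := by
  rw [Fin.sum_univ_eq_sum_range (fun x => if a + 1 = x then f x else 0), Finset.sum_ite_eq]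
  simp

theorem sum_fin_ite_eq_succ (n a : ℕ) (ha : a ≤ n) (f : ℕ → ℂ) :
    ∑ x : Fin (n + 1), (if (x : ℕ) + 1 = a then f x else 0) = if a = 0 then 0 else f (a - 1) := by
  rw [Fin.sum_univ_eq_sum_range (fun x => if x + 1 = a then f x else 0)]
  rcases a with _ | a
  · simp
  · simp only [Nat.add_right_cancel_iff, Finset.sum_ite_eq', Finset.mem_range]
    rw [if_pos (by omega)]
    simp

theorem kronecker_diagonal_mulVec {n : ℕ} (A : Matrix (Fin n) (Fin n) ℂ) (d : Fin n → ℂ)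
    (v : Fin n × Fin n → ℂ) (a b : Fin n) :
    ((A ⊗ₖ diagonal d) *ᵥ v) (a, b) = d b * ∑ x, A a x * v (x, b) := by
  simp only [mulVec, dotProduct, Fintype.sum_prod_type, kroneckerMap_apply, diagonal_apply]
  rw [Finset.mul_sum]
  refine Finset.sum_congr rfl fun x _ => ?_
  rw [Finset.sum_eq_single b]
  · simp; ring
  · intro y _ hy
    simp [hy.symm]
  · simp

theorem diagonal_kronecker_mulVec {n : ℕ} (A : Matrix (Fin n) (Fin n) ℂ) (d : Fin n → ℂ)
    (v : Fin n × Fin n → ℂ) (a b : Fin n) :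
    ((diagonal d ⊗ₖ A) *ᵥ v) (a, b) = d a * ∑ y, A b y * v (a, y) := by
  simp only [mulVec, dotProduct, Fintype.sum_prod_type, kroneckerMap_apply, diagonal_apply]
  rw [Finset.sum_eq_single a]
  · rw [Finset.mul_sum]
    refine Finset.sum_congr rfl fun x _ => ?_
    simp; ring
  · intro y _ hy
    simp [hy.symm]
  · simp

theorem ofReal_rpow_mul_rpow {q : ℝ} (hq : 0 < q) (s t : ℝ) :
    ((q ^ s : ℝ) : ℂ) * ((q ^ t : ℝ) : ℂ) = ((q ^ (s + t) : ℝ) : ℂ) := by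
  rw [Real.rpow_add hq, Complex.ofReal_mul]

/-- `Δ(X⁺)` maps weight zero vectors to vectors of weight one. -/
theorem deltaXp_mulVec_ofSeq (twoS : ℕ) {q : ℝ} (hq : 0 < q) (y : ℕ → ℂ) (a b : Fin (twoS + 1)) :
    (deltaXp twoS q *ᵥ (ofSeq twoS q y).ofLp) (a, b) =
      if (a : ℕ) + b + 1 = twoS then
        ((Real.sqrt (hop twoS q (a + 1)) : ℝ) : ℂ) * (y (a + 1) + y a) else 0 := by
  rw [deltaXp, add_mulVec, Pi.add_apply, opK, opKinv, kronecker_diagonal_mulVec,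
    diagonal_kronecker_mulVec]
  simp only [opXp_apply, ofSeq_apply, ite_mul, zero_mul]
  rw [sum_fin_ite_succ_eq twoS a (fun x => ((Real.sqrt (hop twoS q x) : ℝ) : ℂ) *
      if x + b = twoS then ((q ^ (spin twoS - (x : ℕ)) : ℝ) : ℂ) * y x else 0),
    sum_fin_ite_succ_eq twoS b (fun x => ((Real.sqrt (hop twoS q x) : ℝ) : ℂ) *
      if a + x = twoS then ((q ^ (spin twoS - (a : ℕ)) : ℝ) : ℂ) * y a else 0)]
  by_cases h : (a : ℕ) + b + 1 = twoS
  · have h' : (a : ℝ) + b + 1 = twoS := by exact_mod_cast h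
    rw [if_pos (by omega), if_pos (by omega), if_pos (by omega), if_pos (by omega), if_pos h,
      hop_symm twoS q (a := b + 1) (b := a + 1) (by omega)]
    -- The factor `q^(S - a)` in `ofSeq` is chosen so that it cancels the eigenvalues of `K` and
    -- `K⁻¹` here and in `e2`.
    have e1 : ((q ^ weight twoS b : ℝ) : ℂ) * ((q ^ (spin twoS - ((a + 1 : ℕ) : ℝ)) : ℝ) : ℂ) = 1 := by
      rw [ofReal_rpow_mul_rpow hq, weight, spin, ← h']
      push_cast
      rw [show ((a : ℝ) + b + 1) / 2 - b + (((a : ℝ) + b + 1) / 2 - (a + 1)) = 0 by ring]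
      simp
    have e2 : ((q ^ (-weight twoS a) : ℝ) : ℂ) * ((q ^ (spin twoS - (a : ℝ)) : ℝ) : ℂ) = 1 := by
      rw [ofReal_rpow_mul_rpow hq, weight]
      simp
    linear_combination ((Real.sqrt (hop twoS q (a + 1)) : ℝ) : ℂ) * y (a + 1) * e1 +
      ((Real.sqrt (hop twoS q (a + 1)) : ℝ) : ℂ) * y a * e2
  · rw [if_neg (show ¬ ((a : ℕ) + 1 + b = twoS) by omega),
      if_neg (show ¬ ((a : ℕ) + (b + 1) = twoS) by omega), if_neg h]
    simp

/-- `Δ(X⁻)` maps vectors of weight one to weight zero vectors. -/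
theorem deltaXm_mulVec (twoS : ℕ) {q : ℝ} (z : ℕ → ℂ)
    (w : Fin (twoS + 1) × Fin (twoS + 1) → ℂ)
    (hw : ∀ a b, w (a, b) = if (a : ℕ) + b + 1 = twoS then z a else 0) (a b : Fin (twoS + 1)) :
    (deltaXm twoS q *ᵥ w) (a, b) =
      if (a : ℕ) + b = twoS then ((q ^ ((a : ℕ) - spin twoS) : ℝ) : ℂ) *
        (((Real.sqrt (hop twoS q (a + 1)) : ℝ) : ℂ) * z a +
          ((Real.sqrt (hop twoS q a) : ℝ) : ℂ) * z (a - 1)) else 0 := by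
  rw [deltaXm, add_mulVec, Pi.add_apply, opK, opKinv, kronecker_diagonal_mulVec,
    diagonal_kronecker_mulVec]
  simp only [opXm, conjTranspose_apply, opXp_apply, hw, apply_ite star, star_zero, ite_mul,
    zero_mul]
  simp only [Complex.star_def, Complex.conj_ofReal]
  rw [sum_fin_ite_eq_succ twoS a (by omega) (fun x => ((Real.sqrt (hop twoS q a) : ℝ) : ℂ) *
      if x + b + 1 = twoS then z x else 0),
    sum_fin_ite_eq_succ twoS b (by omega) (fun x => ((Real.sqrt (hop twoS q b) : ℝ) : ℂ) *
      if a + x + 1 = twoS then z a else 0)]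
  -- The case distinction at the boundary is absorbed by `hop_zero`.
  have ha : (if (a : ℕ) = 0 then 0 else ((Real.sqrt (hop twoS q a) : ℝ) : ℂ) *
      if (a : ℕ) - 1 + b + 1 = twoS then z (a - 1) else 0) =
      if (a : ℕ) + b = twoS then ((Real.sqrt (hop twoS q a) : ℝ) : ℂ) * z (a - 1) else 0 := by
    by_cases h0 : (a : ℕ) = 0
    · simp [h0, hop_zero]
    · rw [if_neg h0]
      by_cases h : (a : ℕ) + b = twoS
      · rw [if_pos h, if_pos (by omega)]
      · rw [if_neg h, if_neg (by omega), mul_zero]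
  have hb : (if (b : ℕ) = 0 then 0 else ((Real.sqrt (hop twoS q b) : ℝ) : ℂ) *
      if (a : ℕ) + (b - 1) + 1 = twoS then z a else 0) =
      if (a : ℕ) + b = twoS then ((Real.sqrt (hop twoS q (a + 1)) : ℝ) : ℂ) * z a else 0 := by
    by_cases h : (a : ℕ) + b = twoS
    · rw [if_pos h, hop_symm twoS q (a := a + 1) (b := b) (by omega)]
      by_cases h0 : (b : ℕ) = 0
      · simp [h0, hop_zero]
      · rw [if_neg h0, if_pos (by omega)]
    · rw [if_neg h]
      split_ifs <;> first | omega | simp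
  rw [ha, hb]
  by_cases h : (a : ℕ) + b = twoS
  · have h' : (a : ℝ) + b = twoS := by exact_mod_cast h
    rw [if_pos h, if_pos h, if_pos h]
    have e1 : weight twoS b = (a : ℝ) - spin twoS := by
      rw [weight, spin, ← h']; ring
    have e2 : -weight twoS a = (a : ℝ) - spin twoS := by
      rw [weight]; ring
    rw [e1, e2]
    ring
  · simp [h]

theorem deltaH_mulVec (twoS : ℕ) (v : Fin (twoS + 1) × Fin (twoS + 1) → ℂ)
    (a b : Fin (twoS + 1)) :
    (deltaH twoS *ᵥ v) (a, b) = ((weight twoS a + weight twoS b : ℝ) : ℂ) * v (a, b) := by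
  have : deltaH twoS = diagonal fun i => ((weight twoS i.1 + weight twoS i.2 : ℝ) : ℂ) := by
    simp only [deltaH, opH]
    rw [← diagonal_one, diagonal_kronecker_diagonal, diagonal_kronecker_diagonal, diagonal_add]
    simp
  rw [this, mulVec_diagonal]

theorem deltaK_eq_diagonal (twoS : ℕ) {q : ℝ} (hq : 0 < q) :
    deltaK twoS q = diagonal fun i => ((q ^ (weight twoS i.1 + weight twoS i.2) : ℝ) : ℂ) := by
  simp only [deltaK, opK, diagonal_kronecker_diagonal, ofReal_rpow_mul_rpow hq]

theorem deltaKinv_eq_diagonal (twoS : ℕ) {q : ℝ} (hq : 0 < q) :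
    deltaKinv twoS q = diagonal fun i => ((q ^ (-(weight twoS i.1 + weight twoS i.2)) : ℝ) : ℂ) := by
  simp only [deltaKinv, opKinv, diagonal_kronecker_diagonal, ofReal_rpow_mul_rpow hq, neg_add]

theorem weight_add_weight (twoS : ℕ) (a b : Fin (twoS + 1)) :
    weight twoS a + weight twoS b = (twoS : ℝ) - a - b := by
  simp only [weight, spin]; ring

/-- On weight zero vectors the Casimir operator acts as `X⁻ X⁺`. -/
theorem deltaC_mulVec_ofSeq (twoS : ℕ) {q : ℝ} (hq : 0 < q) (y : ℕ → ℂ) :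
    deltaC twoS q *ᵥ (ofSeq twoS q y).ofLp =
      deltaXm twoS q *ᵥ (deltaXp twoS q *ᵥ (ofSeq twoS q y).ofLp) := by
  have hw : ∀ a b : Fin (twoS + 1), (a : ℕ) + b = twoS → weight twoS a + weight twoS b = 0 := by
    intro a b h
    have h' : (a : ℝ) + b = twoS := by exact_mod_cast h
    rw [weight_add_weight]; linarith
  unfold deltaC
  split_ifs with h
  · have hH : deltaH twoS *ᵥ (ofSeq twoS q y).ofLp = 0 := by
      ext ⟨a, b⟩
      rw [deltaH_mulVec, ofSeq_apply]
      split_ifs with hab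
      · simp [hw a b hab]
      · simp
    -- The factors are commuted so that `Δ(H)`, which kills weight zero vectors, acts first.
    have hc : deltaH twoS * (deltaH twoS + 1) = (deltaH twoS + 1) * deltaH twoS := by
      noncomm_ring
    rw [hc, add_mulVec, ← mulVec_mulVec, ← mulVec_mulVec, hH, mulVec_zero, add_zero]
  · rw [add_mulVec, ← mulVec_mulVec, add_eq_left, smul_mulVec, deltaK_eq_diagonal twoS hq,
      deltaKinv_eq_diagonal twoS hq, diagonal_sub, ← diagonal_smul, ← diagonal_smul, diagonal_sub,
      diagonal_mul_diagonal]
    ext ⟨a, b⟩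
    rw [Pi.smul_apply, mulVec_diagonal, ofSeq_apply]
    split_ifs with hab
    · simp [hw a b hab]
    · simp

theorem sum_prod_ite_antidiagonal (n : ℕ) (f : ℕ → ℝ) :
    ∑ i : Fin (n + 1) × Fin (n + 1), (if (i.1 : ℕ) + i.2 = n then f i.1 else 0) =
      ∑ a ∈ Finset.range (n + 1), f a := by
  rw [Fintype.sum_prod_type, ← Fin.sum_univ_eq_sum_range]
  refine Finset.sum_congr rfl fun a _ => ?_
  rw [Finset.sum_eq_single a.rev]
  · rw [if_pos]
    simp only [Fin.val_rev]; omega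
  · intro b _ hb
    rw [if_neg]
    intro h
    apply hb
    ext
    simp only [Fin.val_rev] at h ⊢; omega
  · simp

theorem norm_sq_ofSeq (twoS : ℕ) {q : ℝ} (hq : 0 < q) (y : ℕ → ℂ) :
    ‖ofSeq twoS q y‖ ^ 2 =
      ∑ a ∈ Finset.range (twoS + 1), q ^ ((twoS : ℝ) - 2 * a) * ‖y a‖ ^ 2 := by
  rw [EuclideanSpace.norm_sq_eq, ← sum_prod_ite_antidiagonal]
  refine Finset.sum_congr rfl fun ⟨a, b⟩ _ => ?_
  rw [ofSeq_apply]
  split_ifs with h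
  · rw [norm_mul, mul_pow, Complex.norm_real, Real.norm_of_nonneg (Real.rpow_nonneg hq.le _),
      ← Real.rpow_natCast, ← Real.rpow_mul hq.le, spin]
    congr 2
    push_cast; ring
  · simp

/-- The image under `X⁻ X⁺` carries the factor `q^(a - S)` and the vector itself `q^(S - a)`; their
quotient is the power `q^(2S - 2a)` in the recurrence. Off the antidiagonal both sides vanish. -/
theorem casimir_ofSeq_iff (twoS : ℕ) {q : ℝ} (hq : 0 < q) (lam : ℝ) (y : ℕ → ℂ) :
    deltaC twoS q *ᵥ (ofSeq twoS q y).ofLp = (lam : ℂ) • (ofSeq twoS q y).ofLp ↔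
      IsCasimirSeq twoS q lam y := by
  rw [deltaC_mulVec_ofSeq twoS hq]
  have key : ∀ a b : Fin (twoS + 1), (a : ℕ) + b = twoS →
      ((deltaXm twoS q *ᵥ (deltaXp twoS q *ᵥ (ofSeq twoS q y).ofLp)) (a, b) =
        ((lam : ℂ) • (ofSeq twoS q y).ofLp) (a, b) ↔
      (hop twoS q (a + 1) : ℂ) * (y (a + 1) + y a) +
        (hop twoS q a : ℂ) * (y a + y (a - 1)) =
          ((lam * q ^ ((twoS : ℝ) - 2 * (a : ℕ)) : ℝ) : ℂ) * y a) := by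
    intro a b h
    rw [deltaXm_mulVec twoS
      (fun a => ((Real.sqrt (hop twoS q (a + 1)) : ℝ) : ℂ) * (y (a + 1) + y a)) _
      (deltaXp_mulVec_ofSeq twoS hq y), if_pos h, Pi.smul_apply,
      ofSeq_apply, if_pos h, smul_eq_mul]
    have s1 : ((Real.sqrt (hop twoS q (a + 1)) : ℝ) : ℂ) * ((Real.sqrt (hop twoS q (a + 1)) : ℝ) : ℂ)
        = (hop twoS q (a + 1) : ℂ) := by
      rw [← Complex.ofReal_mul, Real.mul_self_sqrt (hop_nonneg twoS hq (by omega))]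
    have s2 : ((Real.sqrt (hop twoS q a) : ℝ) : ℂ) * (((Real.sqrt (hop twoS q ((a : ℕ) - 1 + 1)) : ℝ) : ℂ)
        * (y ((a : ℕ) - 1 + 1) + y ((a : ℕ) - 1))) = (hop twoS q a : ℂ) * (y a + y (a - 1)) := by
      rcases Nat.eq_zero_or_pos (a : ℕ) with h0 | h0
      · simp [h0, hop_zero]
      · rw [Nat.sub_add_cancel h0, ← mul_assoc, ← Complex.ofReal_mul,
          Real.mul_self_sqrt (hop_nonneg twoS hq (by omega))]
    rw [s2, ← mul_assoc, s1]
    have e1 : ((q ^ (spin twoS - (a : ℕ)) : ℝ) : ℂ) =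
        ((q ^ ((a : ℕ) - spin twoS) : ℝ) : ℂ) * ((q ^ ((twoS : ℝ) - 2 * (a : ℕ)) : ℝ) : ℂ) := by
      rw [ofReal_rpow_mul_rpow hq]
      congr 2
      rw [spin]; ring
    have e0 : ((q ^ ((a : ℕ) - spin twoS) : ℝ) : ℂ) ≠ 0 := by
      exact_mod_cast (Real.rpow_pos_of_pos hq _).ne'
    rw [e1, Complex.ofReal_mul]
    rw [show ∀ x r t s : ℂ, s * (x * r * t) = x * (s * r * t) by intros; ring]
    exact mul_right_inj' e0
  constructor
  · intro h a ha
    have h1 := (key ⟨a, by omega⟩ ⟨twoS - a, by omega⟩ (by simp; omega)).mp (congrFun h _)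
    exact h1
  · intro h
    ext ⟨a, b⟩
    by_cases hab : (a : ℕ) + b = twoS
    · exact (key a b hab).mpr (h a (by omega))
    · rw [deltaXm_mulVec twoS
      (fun a => ((Real.sqrt (hop twoS q (a + 1)) : ℝ) : ℂ) * (y (a + 1) + y a)) _
      (deltaXp_mulVec_ofSeq twoS hq y), if_neg hab, Pi.smul_apply,
        ofSeq_apply, if_neg hab, smul_zero]

theorem isKet_ofSeq_iff (twoS : ℕ) {q : ℝ} (hq : 0 < q) (J : ℕ) (y : ℕ → ℂ) :
    IsKet twoS q J 0 (ofSeq twoS q y) ↔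
      ∑ a ∈ Finset.range (twoS + 1), q ^ ((twoS : ℝ) - 2 * a) * ‖y a‖ ^ 2 = 1 ∧
      IsCasimirSeq twoS q (qNum q J * qNum q (J + 1)) y := by
  rw [← norm_sq_ofSeq twoS hq, ← casimir_ofSeq_iff twoS hq,
    pow_eq_one_iff_of_nonneg (norm_nonneg (ofSeq twoS q y)) two_ne_zero]
  refine ⟨fun h => ⟨h.norm_eq, h.casimir_eq⟩, fun h => ⟨h.1, ?_, h.2⟩⟩
  have hw : ∀ a b : Fin (twoS + 1), (a : ℕ) + b = twoS → weight twoS a + weight twoS b = 0 := by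
    intro a b h
    have h' : (a : ℝ) + b = twoS := by exact_mod_cast h
    rw [weight_add_weight]; linarith
  split_ifs with h1
  · ext ⟨a, b⟩
    rw [deltaH_mulVec, Pi.smul_apply, ofSeq_apply]
    split_ifs with hab
    · simp [hw a b hab]
    · simp
  · ext ⟨a, b⟩
    rw [deltaK_eq_diagonal twoS hq, mulVec_diagonal, Pi.smul_apply, ofSeq_apply]
    split_ifs with hab
    · simp [hw a b hab]
    · simp

/-- The weight condition determines the support of `|J, m⟩`. -/
theorem IsKet.apply_eq_zero {twoS : ℕ} {q : ℝ} (hq : 0 < q) {J : ℕ} {m : ℤ} {v : Space2 twoS}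
    (h : IsKet twoS q J m v) (a b : Fin (twoS + 1)) (hab : (a : ℤ) + b + m ≠ twoS) :
    v.ofLp (a, b) = 0 := by
  have hne : weight twoS a + weight twoS b ≠ (m : ℝ) := by
    rw [weight_add_weight]
    intro h'
    apply hab
    have : (a : ℝ) + b + m = twoS := by linarith
    exact_mod_cast this
  have hw := h.weight_eq
  split_ifs at hw with h1
  · have h2 := congrFun hw (a, b)
    rw [deltaH_mulVec, Pi.smul_apply, smul_eq_mul, ← sub_eq_zero, ← sub_mul, mul_eq_zero] at h2
    refine h2.resolve_left fun h3 => hne ?_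
    rw [sub_eq_zero] at h3
    exact_mod_cast h3
  · have h2 := congrFun hw (a, b)
    rw [deltaK_eq_diagonal twoS hq, mulVec_diagonal, Pi.smul_apply, smul_eq_mul, ← sub_eq_zero,
      ← sub_mul, mul_eq_zero] at h2
    refine h2.resolve_left fun h3 => hne ?_
    rw [sub_eq_zero] at h3
    have h4 : q ^ (weight twoS a + weight twoS b) = q ^ (m : ℝ) := by
      rw [Real.rpow_intCast]
      exact_mod_cast h3
    exact (Real.rpow_right_inj hq h1).mp h4

theorem IsKet.exists_eq_ofSeq {twoS : ℕ} {q : ℝ} (hq : 0 < q) {J : ℕ} {v : Space2 twoS}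
    (h : IsKet twoS q J 0 v) : ∃ y : ℕ → ℂ, v = ofSeq twoS q y := by
  refine ⟨fun a => if ha : a < twoS + 1 then
    ((q ^ (spin twoS - (a : ℝ)) : ℝ) : ℂ)⁻¹ * v.ofLp (⟨a, ha⟩, Fin.rev ⟨a, ha⟩) else 0, ?_⟩
  refine PiLp.ext fun ⟨a, b⟩ => ?_
  rw [ofSeq_apply]
  split_ifs with hab h3
  · have e0 : ((q ^ (spin twoS - (a : ℕ)) : ℝ) : ℂ) ≠ 0 := by
      exact_mod_cast (Real.rpow_pos_of_pos hq _).ne'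
    have hb : b = a.rev := by
      ext
      simp only [Fin.val_rev]; omega
    rw [mul_inv_cancel_left₀ e0, hb]
  · exact absurd a.2 h3
  · exact h.apply_eq_zero hq a b (by omega)

/-- TL vectors have weight zero. -/
theorem IsTLVector.weight_eq_zero {twoS : ℕ} {q : ℝ} (hq : 0 < q) {J : ℕ} {m : ℤ}
    (h : IsTLVector twoS q J m) : m = 0 := by
  obtain ⟨v, hv, Q, hQ, hT⟩ := h
  rw [isTLSolution_iff_overlap v hv.norm_eq Q hQ] at hT
  by_contra hm
  -- The support lies on `b + d = 2S - m`, which misses column `0` if `m < 0` and column `2S` if `m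
  -- > 0`. Row `d` of the overlap is then zero.
  obtain ⟨d, hd⟩ : ∃ d : Fin (twoS + 1), ∀ b, v.ofLp (b, d) = 0 := by
    rcases lt_or_gt_of_ne hm with hm | hm
    · refine ⟨0, fun b => hv.apply_eq_zero hq _ _ ?_⟩
      have := b.2
      simp only [Fin.val_zero]
      omega
    · refine ⟨Fin.last _, fun b => hv.apply_eq_zero hq _ _ ?_⟩
      simp only [Fin.val_last]
      omega
  have h1 := congrFun (congrFun hT d) d
  simp [mul_apply, overlap, hd] at h1

/-! ### The Temperley–Lieb equations for weight zero vectors -/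

theorem overlap_ofSeq (twoS : ℕ) {q : ℝ} (hq : 0 < q) (y : ℕ → ℂ) :
    overlap (ofSeq twoS q y) = diagonal fun a : Fin (twoS + 1) => star (y a) * y (twoS - a) := by
  ext d e
  simp only [overlap, of_apply, ofSeq_apply]
  rw [Finset.sum_eq_single e.rev]
  · have he : (e : ℕ) + e.rev = twoS := by simp only [Fin.val_rev]; omega
    rw [if_pos he]
    by_cases hde : d = e
    · subst hde
      rw [diagonal_apply_eq, if_pos (by omega)]
      have h' : (d : ℝ) + (d.rev : ℕ) = twoS := by exact_mod_cast he
      -- Opposite positions carry opposite powers of `q`, so the overlap depends on `y` alone.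
      have e1 : ((q ^ (spin twoS - (d : ℕ)) : ℝ) : ℂ) * ((q ^ (spin twoS - (d.rev : ℕ)) : ℝ) : ℂ) = 1 := by
        rw [ofReal_rpow_mul_rpow hq, spin, ← h']
        rw [show ((d : ℝ) + (d.rev : ℕ)) / 2 - d + (((d : ℝ) + (d.rev : ℕ)) / 2 - (d.rev : ℕ)) = 0 by
          ring]
        simp
      rw [show twoS - (d : ℕ) = d.rev by omega, star_mul', Complex.star_def,
        Complex.conj_ofReal]
      linear_combination (starRingEnd ℂ) (y d) * y d.rev * e1
    · rw [diagonal_apply_ne _ hde, if_neg, mul_zero]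
      intro h
      apply hde
      ext
      omega
  · intro b _ hb
    rw [if_neg]
    · simp
    · intro h
      apply hb
      ext
      simp only [Fin.val_rev]; omega
  · simp

theorem isTLSolution_ofSeq_iff (twoS : ℕ) {q : ℝ} (hq : 0 < q) (y : ℕ → ℂ)
    (hn : ‖ofSeq twoS q y‖ = 1) (Q : ℝ) (hQ : 0 < Q) :
    IsTLSolution Q ((Q : ℂ) • proj (ofSeq twoS q y)) ↔
      ∀ a ≤ twoS, Q * (‖y a‖ * ‖y (twoS - a)‖) = 1 := by
  rw [isTLSolution_iff_overlap _ hn Q hQ, overlap_ofSeq twoS hq, diagonal_conjTranspose,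
    diagonal_mul_diagonal, ← diagonal_smul, ← diagonal_one, diagonal_eq_diagonal_iff]
  have key : ∀ a : Fin (twoS + 1),
      ((Q : ℂ) ^ 2 • (star (y a) * y (twoS - a) * star (star (y a) * y (twoS - a))) = 1 ↔
      Q * (‖y a‖ * ‖y (twoS - a)‖) = 1) := by
    intro a
    rw [Complex.star_def, Complex.mul_conj', norm_mul, smul_eq_mul,
      RCLike.norm_conj, ← mul_pow]
    have : (0 : ℝ) ≤ Q * (‖y a‖ * ‖y (twoS - a)‖) := by positivity
    rw [← pow_eq_one_iff_of_nonneg this two_ne_zero]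
    norm_cast
  constructor
  · intro h a ha
    exact (key ⟨a, by omega⟩).mp (h ⟨a, by omega⟩)
  · intro h a
    exact (key a).mpr (h a (by omega))

/-! ## Solutions of the Casimir recurrence -/

/-- Row `a < 2S` has the nonzero leading coefficient `hop (a + 1)`, so `y 0` determines the whole
sequence. This is the uniqueness of `|J, 0⟩` up to a scalar. -/
theorem IsCasimirSeq.proportional {twoS : ℕ} {q : ℝ} (hq : 0 < q) {lam : ℝ} {y z : ℕ → ℂ}
    (hy : IsCasimirSeq twoS q lam y) (hz : IsCasimirSeq twoS q lam z) :
    ∀ a ≤ twoS, y 0 * z a = z 0 * y a := by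
  intro a
  induction a using Nat.strong_induction_on with
  | _ a ih =>
    intro ha
    rcases a with _ | a
    · ring
    · have h1 := ih a (by omega) (by omega)
      have h2 := ih (a - 1) (by omega) (by omega)
      have hF : (hop twoS q (a + 1) : ℂ) ≠ 0 := by
        exact_mod_cast (hop_pos twoS hq (Nat.succ_pos a) ha).ne'
      apply mul_left_cancel₀ hF
      linear_combination y 0 * hz a (by omega) - z 0 * hy a (by omega) +
        (((lam * q ^ ((twoS : ℝ) - 2 * a) : ℝ) : ℂ) - hop twoS q (a + 1) - hop twoS q a) * h1 -
        hop twoS q a * h2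

theorem IsCasimirSeq.const_mul {twoS : ℕ} {q lam : ℝ} {y : ℕ → ℂ}
    (hy : IsCasimirSeq twoS q lam y) (c : ℂ) : IsCasimirSeq twoS q lam fun a => c * y a := by
  intro a ha
  linear_combination c * hy a ha

/-- An explicit solution `z` of the recurrence for which `|z_a z_(2S - a)|` does not depend on `a`
gives a TL vector, and determines the value of `Q`. -/
theorem isTLSolution_iff_of_casimirSeq {twoS : ℕ} {q : ℝ} (hq : 0 < q) {J : ℕ} {z : ℕ → ℂ}
    (hz : IsCasimirSeq twoS q (qNum q J * qNum q (J + 1)) z) (h0 : z 0 = 1) {κ R : ℝ} (hκ : 0 < κ)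
    (hzκ : ∀ a ≤ twoS, ‖z a‖ * ‖z (twoS - a)‖ = κ)
    (hR : ∑ a ∈ Finset.range (twoS + 1), q ^ ((twoS : ℝ) - 2 * a) * ‖z a‖ ^ 2 = κ * R)
    {v : Space2 twoS} (hv : IsKet twoS q J 0 v) {Q : ℝ} (hQ : 0 < Q) :
    IsTLSolution Q ((Q : ℂ) • proj v) ↔ Q = R := by
  obtain ⟨y, rfl⟩ := hv.exists_eq_ofSeq hq
  rw [isTLSolution_ofSeq_iff twoS hq y hv.norm_eq Q hQ]
  obtain ⟨hn, hy⟩ := (isKet_ofSeq_iff twoS hq J y).mp hv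
  have hyz : ∀ a ≤ twoS, ‖y a‖ = ‖y 0‖ * ‖z a‖ := by
    intro a ha
    rw [← norm_mul, hy.proportional hq hz a ha, h0, one_mul]
  -- As `|y_a| = |y_0| |z_a|`, normalization fixes `|y_0|² κ = 1/R`, while the TL condition asks for
  -- `Q |y_0|² κ = 1`.
  have hn' : ‖y 0‖ ^ 2 * (κ * R) = 1 := by
    rw [← hR, ← hn, Finset.mul_sum]
    refine Finset.sum_congr rfl fun a ha => ?_
    rw [hyz a (by simpa [Nat.lt_succ_iff] using ha)]
    ring
  have hy0 : 0 < ‖y 0‖ ^ 2 * κ := by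
    have : ‖y 0‖ ≠ 0 := by
      intro h
      simp [h] at hn'
    positivity
  have key : ∀ a ≤ twoS, Q * (‖y a‖ * ‖y (twoS - a)‖) = Q * (‖y 0‖ ^ 2 * κ) := by
    intro a ha
    rw [hyz a ha, hyz _ (Nat.sub_le _ _), ← hzκ a ha]
    ring
  constructor
  · intro h
    have h1 := h 0 (Nat.zero_le _)
    rw [key 0 (Nat.zero_le _)] at h1
    apply mul_right_cancel₀ hy0.ne'
    rw [h1, ← hn']
    ring
  · rintro rfl a ha
    rw [key a ha, ← hn']
    ring

theorem exists_isKet {twoS : ℕ} {q : ℝ} (hq : 0 < q) {J : ℕ} {z : ℕ → ℂ}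
    (hz : IsCasimirSeq twoS q (qNum q J * qNum q (J + 1)) z) (h0 : z 0 = 1) :
    ∃ v, IsKet twoS q J 0 v := by
  set R := ∑ a ∈ Finset.range (twoS + 1), q ^ ((twoS : ℝ) - 2 * a) * ‖z a‖ ^ 2 with hRdef
  have hR : 0 < R := by
    refine Finset.sum_pos' (fun a _ => by positivity) ⟨0, by simp, ?_⟩
    rw [h0]
    simp only [norm_one]
    positivity
  refine ⟨ofSeq twoS q fun a => ((Real.sqrt R)⁻¹ : ℝ) * z a,
    (isKet_ofSeq_iff twoS hq J _).mpr ⟨?_, hz.const_mul _⟩⟩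
  have : ∀ a ∈ Finset.range (twoS + 1),
      q ^ ((twoS : ℝ) - 2 * a) * ‖(((Real.sqrt R)⁻¹ : ℝ) : ℂ) * z a‖ ^ 2 =
        R⁻¹ * (q ^ ((twoS : ℝ) - 2 * a) * ‖z a‖ ^ 2) := by
    intro a _
    rw [norm_mul, mul_pow, Complex.norm_real, Real.norm_of_nonneg (by positivity), inv_pow,
      Real.sq_sqrt hR.le]
    ring
  rw [Finset.sum_congr rfl this, ← Finset.mul_sum, ← hRdef, inv_mul_cancel₀ hR.ne']

theorem isTLVector_of_casimirSeq {twoS : ℕ} {q : ℝ} (hq : 0 < q) {J : ℕ} {z : ℕ → ℂ}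
    (hz : IsCasimirSeq twoS q (qNum q J * qNum q (J + 1)) z) (h0 : z 0 = 1) {κ R : ℝ} (hκ : 0 < κ)
    (hzκ : ∀ a ≤ twoS, ‖z a‖ * ‖z (twoS - a)‖ = κ)
    (hR : ∑ a ∈ Finset.range (twoS + 1), q ^ ((twoS : ℝ) - 2 * a) * ‖z a‖ ^ 2 = κ * R)
    (hR0 : 0 < R) : IsTLVector twoS q J 0 := by
  obtain ⟨v, hv⟩ := exists_isKet hq hz h0
  exact ⟨v, hv, R, hR0, (isTLSolution_iff_of_casimirSeq hq hz h0 hκ hzκ hR hv hR0).mpr rfl⟩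

/-- Multiplication by `q - q⁻¹` makes the sum telescope. The sum is the squared norm of `ofSeq` for
a sequence of unimodular entries, whence the value `[2S + 1]`. -/
theorem sum_rpow_eq_qNum {q : ℝ} (hq : 0 < q) (n : ℕ) :
    ∑ a ∈ Finset.range (n + 1), q ^ ((n : ℝ) - 2 * a) = qNum q (n + 1) := by
  unfold qNum
  split_ifs with h
  · simp [h]
  · rw [eq_div_iff (sub_inv_ne_zero hq h), Finset.sum_mul]
    have : ∀ a ∈ Finset.range (n + 1), q ^ ((n : ℝ) - 2 * a) * (q - q⁻¹) =
        q ^ ((n : ℝ) + 1 - 2 * (a : ℕ)) - q ^ ((n : ℝ) + 1 - 2 * ((a + 1 : ℕ) : ℝ)) := by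
      intro a _
      rw [mul_sub, ← Real.rpow_add_one hq.ne', ← Real.rpow_neg_one q, ← Real.rpow_add hq]
      congr 2 <;> push_cast <;> ring
    rw [Finset.sum_congr rfl this,
      Finset.sum_range_sub' (fun a : ℕ => q ^ ((n : ℝ) + 1 - 2 * (a : ℝ))) (n + 1)]
    congr 2 <;> push_cast <;> ring

theorem qNum_two {q : ℝ} (hq : 0 < q) : qNum q 2 = q + q⁻¹ := by
  have h := sum_rpow_eq_qNum hq 1
  norm_num [Finset.sum_range_succ] at h
  rw [← h, Real.rpow_neg_one]

/-! ### The solutions giving TL vectors -/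

/-- Consecutive terms cancel and the eigenvalue is `0`: this is the singlet, annihilated by `Δ(X⁺)`.
-/
theorem isCasimirSeq_alternating (twoS : ℕ) (q : ℝ) :
    IsCasimirSeq twoS q (qNum q (0 : ℕ) * qNum q ((0 : ℕ) + 1)) fun a => (-1) ^ a := by
  intro a _
  rcases a with _ | a
  · simp [qNum_zero, hop_zero]
  · simp [qNum_zero, pow_succ]

theorem norm_alternating (twoS a : ℕ) : ‖(-1 : ℂ) ^ a‖ * ‖(-1 : ℂ) ^ (twoS - a)‖ = 1 := by
  simp

theorem sum_norm_alternating {q : ℝ} (hq : 0 < q) (twoS : ℕ) :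
    ∑ a ∈ Finset.range (twoS + 1), q ^ ((twoS : ℝ) - 2 * a) * ‖(-1 : ℂ) ^ a‖ ^ 2 =
      1 * qNum q (twoS + 1) := by
  simp [sum_rpow_eq_qNum hq]

/-- Row `0` reads `y_1 + y_0 = (q + q⁻¹) q y_0`, hence `y_1 = q² y_0`; the product `|y_0 y_1|` is
trivially symmetric since there are only two terms. -/
theorem isCasimirSeq_spin_half {q : ℝ} (hq : 0 < q) :
    IsCasimirSeq 1 q (qNum q (1 : ℕ) * qNum q ((1 : ℕ) + 1)) fun a => (q : ℂ) ^ (2 * a) := by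
  have hq' : (q : ℂ) ≠ 0 := by exact_mod_cast hq.ne'
  have hF : hop 1 q 1 = 1 := by simp [hop, qNum_one hq]
  have hF2 : hop 1 q 2 = 0 := hop_top 1 q
  intro a ha
  have hl : qNum q ((1 : ℕ) + 1) = q + q⁻¹ := by
    rw [← qNum_two hq]
    norm_num
  rw [hl]
  interval_cases a
  · simp [hF, hop_zero, qNum_one hq]
    field_simp
  · norm_num [hF, hF2, qNum_one hq, Real.rpow_neg_one]
    field_simp

theorem norm_spin_half (q : ℝ) (a : ℕ) (ha : a ≤ 1) :
    ‖(q : ℂ) ^ (2 * a)‖ * ‖(q : ℂ) ^ (2 * (1 - a))‖ = q ^ 2 := by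
  interval_cases a <;> simp

theorem sum_norm_spin_half {q : ℝ} (hq : 0 < q) :
    ∑ a ∈ Finset.range (1 + 1), q ^ (((1 : ℕ) : ℝ) - 2 * a) * ‖(q : ℂ) ^ (2 * a)‖ ^ 2 =
      q ^ 2 * qNum q ((1 : ℕ) + 1) := by
  have hl : qNum q ((1 : ℕ) + 1) = q + q⁻¹ := by
    rw [← qNum_two hq]
    norm_num
  rw [hl]
  norm_num [Finset.sum_range_succ, Real.rpow_neg_one]
  field_simp
  ring

/-- The sequence `1, 1, -1, -1`. -/
def signsSpinThreeHalves (a : ℕ) : ℂ := if a ≤ 1 then 1 else -1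

theorem isCasimirSeq_spin_three_halves :
    IsCasimirSeq 3 1 (qNum 1 (2 : ℕ) * qNum 1 ((2 : ℕ) + 1)) signsSpinThreeHalves := by
  intro a ha
  interval_cases a <;> norm_num [hop, qNum, signsSpinThreeHalves]

theorem norm_signsSpinThreeHalves (a : ℕ) : ‖signsSpinThreeHalves a‖ = 1 := by
  unfold signsSpinThreeHalves
  split_ifs <;> simp

theorem sum_norm_signsSpinThreeHalves :
    ∑ a ∈ Finset.range (3 + 1), (1 : ℝ) ^ (((3 : ℕ) : ℝ) - 2 * a) * ‖signsSpinThreeHalves a‖ ^ 2 =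
      1 * qNum 1 ((3 : ℕ) + 1) := by
  simp [norm_signsSpinThreeHalves, qNum]
  norm_num

/-- The vectors in the list are TL vectors, and the value of `Q` is `[2S + 1]_q`. -/
theorem isTLVector_of_mem_list {twoS J : ℕ} {m : ℤ} {q : ℝ} (hq : 0 < q)
    (h : (J = 0 ∧ m = 0) ∨ (twoS = 1 ∧ J = 1 ∧ m = 0) ∨
      (q = 1 ∧ twoS = 3 ∧ J = 2 ∧ m = 0)) : IsTLVector twoS q J m := by
  have hpos : 0 < qNum q (twoS + 1) := qNum_pos hq (by positivity)
  rcases h with ⟨rfl, rfl⟩ | ⟨rfl, rfl, rfl⟩ | ⟨rfl, rfl, rfl, rfl⟩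
  · exact isTLVector_of_casimirSeq hq (isCasimirSeq_alternating twoS q) (by simp) one_pos
      (fun a _ => norm_alternating twoS a) (sum_norm_alternating hq twoS) hpos
  · exact isTLVector_of_casimirSeq hq (isCasimirSeq_spin_half hq) (by simp) (by positivity)
      (norm_spin_half q) (sum_norm_spin_half hq) hpos
  · exact isTLVector_of_casimirSeq hq isCasimirSeq_spin_three_halves
      (by simp [signsSpinThreeHalves]) one_pos
      (fun a _ => by simp [norm_signsSpinThreeHalves]) sum_norm_signsSpinThreeHalves hpos

theorem isTLSolution_iff_of_mem_list {twoS J : ℕ} {m : ℤ} {q : ℝ} (hq : 0 < q)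
    (h : (J = 0 ∧ m = 0) ∨ (twoS = 1 ∧ J = 1 ∧ m = 0) ∨
      (q = 1 ∧ twoS = 3 ∧ J = 2 ∧ m = 0)) {v : Space2 twoS} (hv : IsKet twoS q J m v)
    {Q : ℝ} (hQ : 0 < Q) :
    IsTLSolution Q ((Q : ℂ) • proj v) ↔ Q = qNum q (2 * spin twoS + 1) := by
  rw [show 2 * spin twoS = twoS by rw [spin]; ring]
  rcases h with ⟨rfl, rfl⟩ | ⟨rfl, rfl, rfl⟩ | ⟨rfl, rfl, rfl, rfl⟩
  · exact isTLSolution_iff_of_casimirSeq hq (isCasimirSeq_alternating twoS q) (by simp) one_pos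
      (fun a _ => norm_alternating twoS a) (sum_norm_alternating hq twoS) hv hQ
  · exact isTLSolution_iff_of_casimirSeq hq (isCasimirSeq_spin_half hq) (by simp) (by positivity)
      (norm_spin_half q) (sum_norm_spin_half hq) hv hQ
  · exact isTLSolution_iff_of_casimirSeq hq isCasimirSeq_spin_three_halves
      (by simp [signsSpinThreeHalves]) one_pos
      (fun a _ => by simp [norm_signsSpinThreeHalves]) sum_norm_signsSpinThreeHalves hv hQ

/-! ## Completeness of the lists -/

theorem IsTLVector.exists_casimirSeq {twoS : ℕ} {q : ℝ} (hq : 0 < q) {J : ℕ} {m : ℤ}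
    (h : IsTLVector twoS q J m) :
    m = 0 ∧ ∃ y : ℕ → ℂ, IsCasimirSeq twoS q (qNum q J * qNum q (J + 1)) y ∧
      ∃ Q : ℝ, 0 < Q ∧ ∀ a ≤ twoS, Q * (‖y a‖ * ‖y (twoS - a)‖) = 1 := by
  obtain rfl := h.weight_eq_zero hq
  refine ⟨rfl, ?_⟩
  obtain ⟨v, hv, Q, hQ, hT⟩ := h
  obtain ⟨y, rfl⟩ := hv.exists_eq_ofSeq hq
  exact ⟨y, ((isKet_ofSeq_iff twoS hq J y).mp hv).2, Q, hQ,
    (isTLSolution_ofSeq_iff twoS hq y hv.norm_eq Q hQ).mp hT⟩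

/-! ### Exclusion of all other vectors: the case `q = 1`, then `q = 2` -/

theorem hop_one_param (twoS a : ℕ) : hop twoS 1 a = a * (twoS + 1 - a) := by
  simp [hop, qNum]

/-- At `q = 1` the recurrence is invariant under reversal. -/
theorem IsCasimirSeq.reverse {twoS : ℕ} {lam : ℝ} {y : ℕ → ℂ}
    (hy : IsCasimirSeq twoS 1 lam y) : IsCasimirSeq twoS 1 lam fun a => y (twoS - a) := by
  intro a ha
  have h := hy (twoS - a) (Nat.sub_le _ _)
  rw [Real.one_rpow, mul_one] at h ⊢
  rw [hop_symm twoS 1 (a := twoS - a + 1) (b := a) (by omega),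
    hop_symm twoS 1 (a := twoS - a) (b := a + 1) (by omega),
    show twoS - a - 1 = twoS - (a + 1) by omega] at h
  rcases Nat.eq_zero_or_pos a with h0 | h0
  · subst h0
    simp only [hop_zero, Complex.ofReal_zero] at h ⊢
    linear_combination h
  · rw [show twoS - a + 1 = twoS - (a - 1) by omega] at h
    linear_combination h

/-- The reversed sequence solves the same recurrence, so it is a multiple of `y`. Comparing the end
terms, the factor has modulus `1`, so `|y_(2S - a)| = |y_a|` and the TL condition becomes `Q |y_a|²
= 1`. -/
theorem norm_const_of_one_param {twoS : ℕ} {lam : ℝ} {y : ℕ → ℂ}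
    (hy : IsCasimirSeq twoS 1 lam y) {Q : ℝ} (hQ : 0 < Q)
    (h : ∀ a ≤ twoS, Q * (‖y a‖ * ‖y (twoS - a)‖) = 1) :
    y 0 ≠ 0 ∧ ∀ a ≤ twoS, ‖y a‖ = ‖y 0‖ := by
  have h0 : y 0 ≠ 0 := by
    intro h0
    simpa [h0] using h 0 (Nat.zero_le _)
  have h0' : 0 < ‖y 0‖ := norm_pos_iff.mpr h0
  have hp : ∀ a ≤ twoS, ‖y 0‖ * ‖y (twoS - a)‖ = ‖y twoS‖ * ‖y a‖ := by
    intro a ha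
    rw [← norm_mul, ← norm_mul, hy.proportional one_pos hy.reverse a ha, Nat.sub_zero]
  have hN : ‖y twoS‖ = ‖y 0‖ := by
    have := hp twoS le_rfl
    rw [Nat.sub_self] at this
    nlinarith [norm_nonneg (y twoS)]
  have hrev : ∀ a ≤ twoS, ‖y (twoS - a)‖ = ‖y a‖ := by
    intro a ha
    have := hp a ha
    rw [hN] at this
    exact mul_left_cancel₀ h0'.ne' this
  refine ⟨h0, fun a ha => ?_⟩
  have h1 := h a ha
  have h2 := h 0 (Nat.zero_le _)
  rw [hrev a ha] at h1
  rw [hrev 0 (Nat.zero_le _)] at h2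
  have h3 : ‖y a‖ * ‖y a‖ = ‖y 0‖ * ‖y 0‖ := mul_left_cancel₀ hQ.ne' (h1.trans h2.symm)
  exact (mul_self_inj (norm_nonneg _) (norm_nonneg _)).mp h3

theorem real_ratio_eq {r : ℝ} {x y : ℂ} (h : y = r * x) (hn : ‖y‖ = ‖x‖) (hx : x ≠ 0) :
    r = 1 ∨ r = -1 := by
  rw [h, norm_mul, Complex.norm_real, Real.norm_eq_abs] at hn
  have : |r| = 1 := by
    apply mul_right_cancel₀ (norm_ne_zero_iff.mpr hx)
    rw [hn, one_mul]
  exact eq_or_eq_neg_of_abs_eq this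

theorem mem_list_of_isTLVector_one {twoS J : ℕ} {m : ℤ} (hJ : J ≤ twoS)
    (h : IsTLVector twoS 1 J m) :
    (J = 0 ∧ m = 0) ∨ (twoS = 1 ∧ J = 1 ∧ m = 0) ∨ (twoS = 3 ∧ J = 2 ∧ m = 0) := by
  obtain ⟨rfl, y, hy, Q, hQ, hc⟩ := h.exists_casimirSeq one_pos
  obtain ⟨h0, hn⟩ := norm_const_of_one_param hy hQ hc
  have hne : ∀ a ≤ twoS, y a ≠ 0 := by
    intro a ha
    rw [← norm_pos_iff, hn a ha, norm_pos_iff]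
    exact h0
  have hrow : ∀ a ≤ twoS, ((a : ℂ) + 1) * ((twoS : ℂ) - a) * (y (a + 1) + y a) +
      (a : ℂ) * ((twoS : ℂ) + 1 - a) * (y a + y (a - 1)) = (J : ℂ) * (J + 1) * y a := by
    intro a ha
    have := hy a ha
    simp only [hop_one_param, Real.one_rpow, qNum, if_true] at this
    push_cast at this
    linear_combination this
  rcases Nat.eq_zero_or_pos J with hJ0 | hJ0
  · exact Or.inl ⟨hJ0, rfl⟩
  right
  have hJ0' : (0 : ℝ) < J := by exact_mod_cast hJ0
  have hN1 : 1 ≤ twoS := hJ0.trans_le hJ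
  have hN0 : (0 : ℝ) < twoS := by exact_mod_cast hN1
  have hN0' : (twoS : ℂ) ≠ 0 := by exact_mod_cast hN0.ne'
  have r0 := hrow 0 (Nat.zero_le _)
  simp only [Nat.cast_zero, zero_add, sub_zero, zero_mul, add_zero, one_mul] at r0
  have e1 : y 1 = (((J : ℝ) * (J + 1) / twoS - 1 : ℝ) : ℂ) * y 0 := by
    push_cast
    field_simp
    linear_combination r0
  -- Row `0` gives the ratio `J(J + 1)/2S - 1`. It must be `±1`, and `-1` would mean `J = 0`.
  have hlam : (J : ℝ) * (J + 1) = 2 * twoS := by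
    rcases real_ratio_eq e1 (hn 1 hN1) h0 with h | h
    · field_simp at h
      linarith
    · exfalso
      have : (J : ℝ) * (J + 1) / twoS = 0 := by linarith
      have : 0 < (J : ℝ) * (J + 1) / twoS := by positivity
      linarith
  have hlam' : J * (J + 1) = 2 * twoS := by exact_mod_cast hlam
  have hlamC : (J : ℂ) * (J + 1) = 2 * twoS := by exact_mod_cast hlam'
  rw [hlamC] at r0
  have e1' : y 1 = y 0 := by
    apply mul_left_cancel₀ hN0'
    linear_combination r0
  rcases hN1.eq_or_lt with hN | hN2
  · left
    refine ⟨hN.symm, ?_, rfl⟩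
    omega
  have r1 := hrow 1 hN1
  rw [hlamC] at r1
  norm_num at r1
  have hN2' : (2 : ℝ) ≤ twoS := by exact_mod_cast hN2
  -- With `y_1 = y_0` and eigenvalue `2 · 2S`, row `1` collapses to `2 (2S - 1)(y_2 + y_1) = 0`.
  have e2 : y 2 = -y 1 := by
    have : (twoS : ℂ) - 1 ≠ 0 := by
      have : (twoS : ℝ) - 1 ≠ 0 := by linarith
      exact_mod_cast this
    apply mul_left_cancel₀ (mul_ne_zero two_ne_zero this)
    linear_combination r1 + (twoS : ℂ) * e1'
  have r2 := hrow 2 hN2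
  rw [hlamC] at r2
  norm_num at r2
  -- The backward term of row `2` drops out, leaving `3 (2S - 2)(y_3 + y_2) = 2 · 2S · y_2`. For `2S
  -- = 2` this forces `y_2 = 0`.
  rw [show y 1 = -y 2 by rw [e2, neg_neg]] at r2
  rcases (Nat.succ_le_of_lt hN2).eq_or_lt with hN | hN3
  · exfalso
    rw [← hN] at r2
    norm_num at r2
    exact hne 2 (by omega) r2
  have hN3' : (3 : ℝ) ≤ twoS := by exact_mod_cast hN3
  have hN3R : (twoS : ℝ) - 2 ≠ 0 := by linarith
  have hN3C : (twoS : ℂ) - 2 ≠ 0 := by exact_mod_cast hN3R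
  have e3 : y 3 = ((2 * (twoS : ℝ) / (3 * (twoS - 2)) - 1 : ℝ) : ℂ) * y 2 := by
    push_cast
    field_simp
    linear_combination r2
  -- The ratio `+1` gives `2S = 3 (2S - 2)`, that is `2S = 3`; the ratio `-1` would give `2S = 0`.
  have hN : (twoS : ℝ) = 3 := by
    rcases real_ratio_eq e3 ((hn 3 hN3).trans (hn 2 hN2).symm) (hne 2 hN2) with h | h
    · field_simp at h
      linarith
    · exfalso
      have h1 : 2 * (twoS : ℝ) / (3 * (twoS - 2)) = 0 := by linarith
      have h2 : 0 < 2 * (twoS : ℝ) / (3 * (twoS - 2)) := by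
        apply div_pos <;> linarith
      linarith
  right
  have hN' : twoS = 3 := by exact_mod_cast hN
  subst hN'
  refine ⟨rfl, ?_, rfl⟩
  interval_cases J <;> omega

/-- The vector `|2, 0⟩` for `S = 3/2` is not a TL vector at `q = 2`. -/
theorem not_isTLVector_two : ¬ IsTLVector 3 2 2 0 := by
  intro h
  obtain ⟨-, y, hy, Q, hQ, hc⟩ := h.exists_casimirSeq two_pos
  have q1 : qNum 2 1 = 1 := qNum_one two_pos
  have q2 : qNum 2 2 = 5 / 2 := by rw [qNum_two two_pos]; norm_num
  have q3 : qNum 2 3 = 21 / 4 := by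
    have h := sum_rpow_eq_qNum (q := 2) two_pos 2
    norm_num [Finset.sum_range_succ, Real.rpow_neg] at h
    exact h.symm
  have f1 : hop 3 2 1 = 21 / 4 := by norm_num [hop, q1, q3]
  have f2 : hop 3 2 2 = 25 / 4 := by norm_num [hop, q2]
  have f3 : hop 3 2 3 = 21 / 4 := by norm_num [hop, q1, q3]
  have f4 : hop 3 2 4 = 0 := hop_top 3 2
  have r0 := hy 0 (by norm_num)
  have r1 := hy 1 (by norm_num)
  have r3 := hy 3 (by norm_num)
  norm_num [f1, f2, f3, f4, hop_zero, q1, q2, q3, Real.rpow_neg] at r0 r1 r3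
  have e1 : y 1 = 19 * y 0 := by linear_combination 4 / 21 * r0
  have e2 : y 2 = 44 * y 0 := by
    rw [e1] at r1
    linear_combination 4 / 25 * r1
  have e3 : y 3 = -64 * y 0 := by
    rw [e2] at r3
    linear_combination 64 / 231 * r3
  have c0 := hc 0 (by norm_num)
  -- The solution is proportional to `1, 19, 44, -64`, and the products `1 · 64` and `19 · 44`
  -- differ.
  have c1 := hc 1 (by norm_num)
  norm_num [e1, e2, e3] at c0 c1
  nlinarith

end TLVec

end

open TLVec in
theorem theorem5 :
    -- (a) the list of TL vectors at `q = 1`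
    (∀ (twoS J : ℕ) (m : ℤ), J ≤ twoS → |m| ≤ (J : ℤ) →
      (IsTLVector twoS 1 J m ↔
        (J = 0 ∧ m = 0) ∨ (twoS = 1 ∧ J = 1 ∧ m = 0) ∨ (twoS = 3 ∧ J = 2 ∧ m = 0))) ∧
    -- (a) the value of `Q` is `2S + 1`
    (∀ (twoS J : ℕ) (m : ℤ),
      (J = 0 ∧ m = 0) ∨ (twoS = 1 ∧ J = 1 ∧ m = 0) ∨ (twoS = 3 ∧ J = 2 ∧ m = 0) →
      ∀ v : Space2 twoS, IsKet twoS 1 J m v →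
      ∀ Q : ℝ, 0 < Q →
        (IsTLSolution Q ((Q : ℂ) • proj v) ↔ Q = 2 * spin twoS + 1)) ∧
    -- (b) the list of vectors that are TL vectors for all `q > 0`
    (∀ (twoS J : ℕ) (m : ℤ), J ≤ twoS → |m| ≤ (J : ℤ) →
      ((∀ q : ℝ, 0 < q → IsTLVector twoS q J m) ↔
        (J = 0 ∧ m = 0) ∨ (twoS = 1 ∧ J = 1 ∧ m = 0))) ∧
    -- (b) the value of `Q` is `[2S + 1]_q`
    (∀ (twoS J : ℕ) (m : ℤ),
      (J = 0 ∧ m = 0) ∨ (twoS = 1 ∧ J = 1 ∧ m = 0) →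
      ∀ q : ℝ, 0 < q →
      ∀ v : Space2 twoS, IsKet twoS q J m v →
      ∀ Q : ℝ, 0 < Q →
        (IsTLSolution Q ((Q : ℂ) • proj v) ↔ Q = qNum q (2 * spin twoS + 1))) := by
  refine ⟨fun twoS J m hJ _ => ⟨mem_list_of_isTLVector_one hJ, fun h => ?_⟩,
    fun twoS J m h v hv Q hQ => ?_, fun twoS J m hJ _ => ⟨fun h => ?_, fun h q hq => ?_⟩,
    fun twoS J m h q hq v hv Q hQ => ?_⟩
  · exact isTLVector_of_mem_list one_pos (by tauto)
  · rw [isTLSolution_iff_of_mem_list one_pos (by tauto) hv hQ, qNum, if_pos rfl]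
  -- The hypothesis for all `q` is needed only at `q = 1`, and at `q = 2` to discard the third case.
  · rcases mem_list_of_isTLVector_one hJ (h 1 one_pos) with h1 | h1 | ⟨rfl, rfl, rfl⟩
    · exact Or.inl h1
    · exact Or.inr h1
    · exact absurd (h 2 two_pos) not_isTLVector_two
  · exact isTLVector_of_mem_list hq (by tauto)
  · exact isTLSolution_iff_of_mem_list hq (by tauto) hv hQ
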